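/- **Theorem (almost sure convergence of regularized SGD).** Let $\mathcal X$ be a separable real Hilbert space and let $f:\mathcal X\to\mathbb R$ be convex and differentiable with $L$-Lipschitz gradient and $\operatorname{argmin} f\neq\emptyset$. Let $x_*$ be the element of $\operatorname{argmin} f$ of minimal norm, and for $\lambda>0$ let $x_\lambda$ be the unique minimizer of $f_\lambda(x)=f(x)+\frac{\lambda}{2}\|x\|^2$. On a probability space with a filtration $(\mathcal F_k)_{k\ge 0}$, let $(X_k)_{k\ge0}$ be an adapted $\mathcal X$-valued sequence with $\mathbb E\|X_0\|^2<\infty$ and $$X_k=X_{k-1}-\alpha_k\big(\nabla f(X_{k-1})+\lambda_kX_{k-1}+D_k\big),\qquad k\ge 1,$$ where * $(D_k)_{k\ge1}$ is an adapted sequence of integrable $\mathcal X$-valued random variables with $\mathbb E[D_k\mid\mathcal F_{k-1}]=0$ for all $k\ge1$, and for some constants $A,C\ge0$, $$\mathbb E\big[\|D_k\|^2\mid\mathcal F_{k-1}\big]\le A\big(f(X_{k-1})-f(x_*)\big)+C\quad\text{almost surely, for all } k\ge 1;$$ * $(\alpha_k)_{k\ge1}$ and $(\lambda_k)_{k\ge1}$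 are (possibly random) sequences of non-negative reals that are predictable ($\alpha_k$ and $\lambda_k$ are $\mathcal F_{k-1}$-measurable for all $k\ge1$) and uniformly bounded from above by deterministic constants. Assume that, almost surely, the sequence $(\lambda_k)_{k\ge1}$ is decreasing (not necessarily strictly) to $0$ and $$\sum_{k\ge1}\alpha_k\lambda_k=\infty,\qquad \sum_{k\ge1}\alpha_k^2<\infty,\qquad \sum_{k\ge1}\alpha_k\lambda_k\big(\|x_*\|^2-\|x_{\lambda_k}\|^2\big)<\infty .$$ Then $X_k\to x_*$ in norm, almost surely. -/

import Mathlib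

open MeasureTheory ProbabilityTheory Filter Topology
open scoped Gradient NNReal ENNReal

section Deterministic

variable {H : Type*} [NormedAddCommGroup H] [InnerProductSpace ℝ H]

/-- The set `argmin g` of global minimizers of `g`. -/
def argminSet (g : H → ℝ) : Set H := {x | IsMinOn g Set.univ x}

/-- The minimum-norm element of `argmin g`. For a convex continuous `g` on a Hilbert space with
nonempty `argmin g` it exists and is unique (the metric projection of `0` onto the closed convex
set `argmin g`). -/
noncomputable def minNormMinimizer (g : H → ℝ) : H :=
  Classical.epsilon fun x => x ∈ argminSet g ∧ ∀ y ∈ argminSet g, ‖x‖ ≤ ‖y‖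

/-- The Tikhonov regularized objective `f_μ(x) = f(x) + (μ / 2) ‖x‖²`. -/
noncomputable def tikhonov (f : H → ℝ) (μ : ℝ) (x : H) : ℝ := f x + μ / 2 * ‖x‖ ^ 2

/-- `x_μ = argmin f_μ`, the minimizer of the Tikhonov regularized objective; it exists and is
unique for `μ > 0` and `f` convex and continuous on a Hilbert space. -/
noncomputable def tikhonovMinimizer (f : H → ℝ) (μ : ℝ) : H :=
  Classical.epsilon fun x => x ∈ argminSet (tikhonov f μ)

end Deterministic

/-- `X` is generated by the regularized stochastic gradient descent scheme
`X_k = X_{k-1} - α_k (∇f(X_{k-1}) + lam_k X_{k-1} + D_k)`, `k ≥ 1`, where `α_k` and `lam_k` are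
non-negative and `D` is a sequence of martingale differences. The indices `k ≥ 1` are written
`k + 1` with `k : ℕ`; the values of `α`, `lam`, `D` at index `0` play no role. -/
structure IsRegSGD {H : Type*} [NormedAddCommGroup H] [InnerProductSpace ℝ H] [CompleteSpace H]
    {Ω : Type*} {mΩ : MeasurableSpace Ω} (P : Measure Ω) (ℱ : Filtration ℕ mΩ) (f : H → ℝ)
    (α lam : ℕ → Ω → ℝ) (D X : ℕ → Ω → H) : Prop where
  /-- the iterates are adapted -/
  adapted : ∀ k, StronglyMeasurable[ℱ k] (X k)
  /-- `E ‖X_0‖² < ∞` -/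
  memLp_zero : MemLp (X 0) 2 P
  /-- the step-sizes are non-negative -/
  step_nonneg : ∀ᵐ ω ∂P, ∀ k, 0 ≤ α (k + 1) ω
  /-- the regularization parameters are non-negative -/
  reg_nonneg : ∀ᵐ ω ∂P, ∀ k, 0 ≤ lam (k + 1) ω
  /-- the noise is adapted -/
  noise_adapted : ∀ k, StronglyMeasurable[ℱ (k + 1)] (D (k + 1))
  /-- the noise is integrable -/
  noise_integrable : ∀ k, Integrable (D (k + 1)) P
  /-- `E[D_k | ℱ_{k-1}] = 0` -/
  noise_condExp : ∀ k, P[D (k + 1) | ℱ k] =ᵐ[P] 0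
  /-- the recursion -/
  recursion : ∀ᵐ ω ∂P, ∀ k,
    X (k + 1) ω = X k ω - α (k + 1) ω • (∇ f (X k ω) + lam (k + 1) ω • X k ω + D (k + 1) ω)

/-- The ABC condition `E[‖D_k‖² | ℱ_{k-1}] ≤ A (f(X_{k-1}) - f(x_*)) + C`, `k ≥ 1`, where `x_*` is
the minimum-norm minimizer of `f`. The conditional expectation is the one of the `[0, ∞]`-valued
random variable `‖D_k‖²`, so that no integrability of `‖D_k‖²` is presupposed. -/
def ABCCondition {H : Type*} [NormedAddCommGroup H] [InnerProductSpace ℝ H]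
    {Ω : Type*} {mΩ : MeasurableSpace Ω} (P : Measure Ω) (ℱ : Filtration ℕ mΩ) (f : H → ℝ)
    (A C : ℝ) (D X : ℕ → Ω → H) : Prop :=
  ∀ k, ∀ᵐ ω ∂P, condLExp (ℱ k) P (fun ω' => ‖D (k + 1) ω'‖ₑ ^ 2) ω ≤
    ENNReal.ofReal (A * (f (X k ω) - f (minNormMinimizer f)) + C)

/-! ### Convex analysis of the Tikhonov path -/

section Deterministic

/-! The Lyapunov function is `V k = ‖X k - x_*‖ ^ 2`, measured from the fixed point `x_*` rather
than from the moving `x_λ`. The regularized gradient pulls towards `x_*` with strength `λ V / 2`, up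
to an error `λ / 2` times the bias `‖x_*‖ ^ 2 - ‖x_λ‖ ^ 2` (`le_inner_gradient_add_smul`). Expanding
one step, the noise is centred and its second moment grows at most linearly in `V`, so with `α`, `λ`
at index `k + 1` `E[V (k+1) | ℱ k] ≤ (1 + K α²) V k - α λ V k + (α λ bias + K' α²)`
(`IsRegSGD.condExp_le`). The `K α²` and the last bracket are summable, so `robbins_siegmund` gives
almost surely that `V` converges and that `∑ α λ V < ∞`. As `∑ α λ = ∞`, the limit can only be `0`
(`tendsto_zero_of_summable_mul`). -/

theorem bddBelow_range_of_argminSet_nonempty {E : Type*} {f : E → ℝ} (hne : (argminSet f).Nonempty) :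
    BddBelow (Set.range f) := by
  obtain ⟨z, hz⟩ := hne
  exact ⟨f z, Set.forall_mem_range.2 (isMinOn_univ_iff.1 hz)⟩

/-- The Tikhonov bias `‖x_*‖² - ‖x_μ‖²`, extended by `0` to `μ ≤ 0`. -/
noncomputable def tikhonovBias {E : Type*} [NormedAddCommGroup E] (f : E → ℝ) (μ : ℝ) : ℝ :=
  if 0 < μ then ‖minNormMinimizer f‖ ^ 2 - ‖tikhonovMinimizer f μ‖ ^ 2 else 0


/-- At `μ = 0` the factor `μ` kills both sides, so the unspecified value of `tikhonovMinimizer f 0`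
never matters. -/
theorem mul_tikhonovBias {E : Type*} [NormedAddCommGroup E] {f : E → ℝ} {μ : ℝ} (hμ : 0 ≤ μ) :
    μ * tikhonovBias f μ =
      μ * (‖minNormMinimizer f‖ ^ 2 - ‖tikhonovMinimizer f μ‖ ^ 2) := by
  rcases hμ.eq_or_lt with rfl | h
  · simp
  · simp [tikhonovBias, h]

variable {H : Type*} [NormedAddCommGroup H] [InnerProductSpace ℝ H]

/-- First-order characterization of convexity: the tangent plane lies below the graph. -/
theorem ConvexOn.add_inner_gradient_le [CompleteSpace H] {f : H → ℝ}
    (hf : ConvexOn ℝ Set.univ f) {x : H} (hx : DifferentiableAt ℝ f x) (y : H) :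
    f x + inner ℝ (∇ f x) (y - x) ≤ f y := by
  have hconv : ConvexOn ℝ Set.univ (f ∘ AffineMap.lineMap (k := ℝ) x y) := by
    simpa using hf.comp_affineMap (AffineMap.lineMap (k := ℝ) x y)
  have hder : HasDerivAt (f ∘ AffineMap.lineMap (k := ℝ) x y) (fderiv ℝ f x (y - x)) 0 := by
    have h := (AffineMap.lineMap (k := ℝ) x y).hasDerivAt (x := (0 : ℝ))
    have hx' : HasFDerivAt f (fderiv ℝ f x) (AffineMap.lineMap (k := ℝ) x y 0) := by
      simpa using hx.hasFDerivAt
    simpa using hx'.comp_hasDerivAt (0 : ℝ) h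
  have h := hconv.le_slope_of_hasDerivAt (Set.mem_univ 0) (Set.mem_univ 1) one_pos hder
  rw [slope_def_field] at h
  simp [inner_gradient_left] at h ⊢
  linarith

theorem exists_minNorm_of_isClosed_convex [CompleteSpace H] {s : Set H} (hs : s.Nonempty)
    (hc : IsClosed s) (hconv : Convex ℝ s) : ∃ x ∈ s, ∀ y ∈ s, ‖x‖ ≤ ‖y‖ := by
  obtain ⟨x, hx, h⟩ := exists_norm_eq_iInf_of_complete_convex hs hc.isComplete hconv 0
  refine ⟨x, hx, fun y hy => ?_⟩
  have : ‖(0 : H) - x‖ ≤ ‖(0 : H) - y‖ :=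
    h ▸ ciInf_le ⟨0, Set.forall_mem_range.2 fun _ => norm_nonneg _⟩ (⟨y, hy⟩ : s)
  simpa using this

theorem minNormMinimizer_spec [CompleteSpace H] {f : H → ℝ} (hf : ConvexOn ℝ Set.univ f)
    (hcont : Continuous f) (hne : (argminSet f).Nonempty) :
    minNormMinimizer f ∈ argminSet f ∧ ∀ y ∈ argminSet f, ‖minNormMinimizer f‖ ≤ ‖y‖ := by
  obtain ⟨z, hz⟩ := hne
  have heq : argminSet f = {x | f x ≤ f z} := by
    ext x
    refine ⟨fun hx => isMinOn_univ_iff.1 hx z, fun hx => isMinOn_univ_iff.2 fun y => ?_⟩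
    exact le_trans hx (isMinOn_univ_iff.1 hz y)
  obtain ⟨x, hx⟩ := exists_minNorm_of_isClosed_convex (s := argminSet f) ⟨z, hz⟩
    (heq ▸ isClosed_le hcont continuous_const)
    (by simpa [heq] using hf.convex_le (f z))
  exact Classical.epsilon_spec (p := fun x => x ∈ argminSet f ∧ ∀ y ∈ argminSet f, ‖x‖ ≤ ‖y‖)
    ⟨x, hx⟩

/-- Strong convexity of the quadratic term, by expanding squares. It makes minimizing sequences
Cauchy, so existence needs no weak compactness. -/
theorem tikhonov_midpoint_le {f : H → ℝ} (hf : ConvexOn ℝ Set.univ f) (μ : ℝ) (x y : H) :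
    tikhonov f μ ((1 / 2 : ℝ) • x + (1 / 2 : ℝ) • y) + μ / 8 * ‖x - y‖ ^ 2
      ≤ (tikhonov f μ x + tikhonov f μ y) / 2 := by
  obtain ⟨-, hf⟩ := hf
  have h := hf (Set.mem_univ x) (Set.mem_univ y) (a := 1 / 2) (b := 1 / 2)
    (by norm_num) (by norm_num) (by norm_num)
  have h1 : ‖(1 / 2 : ℝ) • x + (1 / 2 : ℝ) • y‖ ^ 2
      = (‖x‖ ^ 2 + 2 * inner ℝ x y + ‖y‖ ^ 2) / 4 := by
    rw [← smul_add, norm_smul, mul_pow, norm_add_sq_real]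
    norm_num
    ring
  have h2 := norm_sub_sq_real x y
  simp only [smul_eq_mul] at h
  unfold tikhonov
  rw [h1, h2]
  linarith

/-- A Tikhonov regularization of a convex function bounded below has a minimizer. -/
theorem exists_mem_argminSet_tikhonov [CompleteSpace H] {f : H → ℝ}
    (hf : ConvexOn ℝ Set.univ f) (hcont : Continuous f) (hbdd : BddBelow (Set.range f))
    {μ : ℝ} (hμ : 0 < μ) : ∃ x, x ∈ argminSet (tikhonov f μ) := by
  set g := tikhonov f μ with hg
  have hgc : Continuous g := by unfold g tikhonov; fun_prop
  have hgb : BddBelow (Set.range g) := by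
    obtain ⟨b, hb⟩ := hbdd
    refine ⟨b, Set.forall_mem_range.2 fun x => ?_⟩
    have := hb (Set.mem_range_self x)
    simp only [hg, tikhonov]
    have : 0 ≤ μ / 2 * ‖x‖ ^ 2 := by positivity
    linarith
  set m := ⨅ x, g x
  have hm : ∀ x, m ≤ g x := fun x => ciInf_le hgb x
  have hex : ∀ n : ℕ, ∃ x, g x < m + 1 / ((n : ℝ) + 1) := fun n =>
    exists_lt_of_ciInf_lt (lt_add_of_pos_right _ Nat.one_div_pos_of_nat)
  choose u hu using hex
  have hε : Tendsto (fun n : ℕ => 1 / ((n : ℝ) + 1)) atTop (𝓝 0) :=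
    tendsto_one_div_add_atTop_nhds_zero_nat
  -- Both values lie below `m + 1 / (N + 1)` and the midpoint value is at least `m`, so the strong
  -- convexity gap `μ / 8 * ‖u p - u q‖ ^ 2` is at most `1 / (N + 1)`.
  have hdist : ∀ p q N : ℕ, N ≤ p → N ≤ q → dist (u p) (u q) ≤ √(8 / μ * (1 / ((N : ℝ) + 1))) := by
    intro p q N hp hq
    have h := tikhonov_midpoint_le hf μ (u p) (u q)
    have h1 := hm ((1 / 2 : ℝ) • u p + (1 / 2 : ℝ) • u q)
    have h2 : 1 / ((p : ℝ) + 1) ≤ 1 / ((N : ℝ) + 1) := by gcongr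
    have h3 : 1 / ((q : ℝ) + 1) ≤ 1 / ((N : ℝ) + 1) := by gcongr
    have h4 := hu p
    have h5 := hu q
    rw [← hg] at h
    rw [dist_eq_norm]
    apply Real.le_sqrt_of_sq_le
    have h6 : μ / 8 * ‖u p - u q‖ ^ 2 ≤ 1 / ((N : ℝ) + 1) := by linarith
    calc ‖u p - u q‖ ^ 2 = 8 / μ * (μ / 8 * ‖u p - u q‖ ^ 2) := by field_simp
      _ ≤ _ := by gcongr
  have hcau : CauchySeq u := by
    refine cauchySeq_of_le_tendsto_0 _ hdist ?_
    have := (hε.const_mul (8 / μ)).sqrt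
    simpa using this
  obtain ⟨x, hx⟩ := cauchySeq_tendsto_of_complete hcau
  refine ⟨x, isMinOn_univ_iff.2 fun y => le_trans ?_ (hm y)⟩
  have h1 : Tendsto (fun n => g (u n)) atTop (𝓝 (g x)) := (hgc.tendsto x).comp hx
  have h2 : Tendsto (fun n : ℕ => m + 1 / ((n : ℝ) + 1)) atTop (𝓝 m) := by
    simpa using hε.const_add m
  exact le_of_tendsto_of_tendsto' h1 h2 fun n => (hu n).le

theorem tikhonovMinimizer_le [CompleteSpace H] {f : H → ℝ}
    (hf : ConvexOn ℝ Set.univ f) (hcont : Continuous f) (hbdd : BddBelow (Set.range f))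
    {μ : ℝ} (hμ : 0 < μ) (y : H) :
    tikhonov f μ (tikhonovMinimizer f μ) ≤ tikhonov f μ y :=
  isMinOn_univ_iff.1 (Classical.epsilon_spec (p := fun x => x ∈ argminSet (tikhonov f μ))
    (exists_mem_argminSet_tikhonov hf hcont hbdd hμ)) y

variable [CompleteSpace H] {f : H → ℝ}

theorem tikhonovBias_nonneg (hf : ConvexOn ℝ Set.univ f) (hcont : Continuous f)
    (hne : (argminSet f).Nonempty) (μ : ℝ) : 0 ≤ tikhonovBias f μ := by
  unfold tikhonovBias
  split_ifs with hμ
  · have h1 := tikhonovMinimizer_le hf hcont (bddBelow_range_of_argminSet_nonempty hne) hμ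
      (minNormMinimizer f)
    have h2 := isMinOn_univ_iff.1 (minNormMinimizer_spec hf hcont hne).1 (tikhonovMinimizer f μ)
    unfold tikhonov at h1
    nlinarith
  · exact le_rfl

/-- Adding the optimality inequalities of `x_μ` and `x_ν`, each tested at the other, gives `(ν - μ)
(‖x_ν‖ ^ 2 - ‖x_μ‖ ^ 2) ≤ 0`. Monotonicity on all of `ℝ` is what makes the bias of a random
parameter measurable. -/
theorem monotone_tikhonovBias (hf : ConvexOn ℝ Set.univ f) (hcont : Continuous f)
    (hne : (argminSet f).Nonempty) : Monotone (tikhonovBias f) := by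
  intro μ ν hμν
  by_cases hμ : 0 < μ
  · have hν := hμ.trans_le hμν
    have hb := bddBelow_range_of_argminSet_nonempty hne
    simp only [tikhonovBias, hμ, hν, if_true]
    rcases hμν.eq_or_lt with rfl | hlt
    · exact le_rfl
    have h1 := tikhonovMinimizer_le hf hcont hb hμ (tikhonovMinimizer f ν)
    have h2 := tikhonovMinimizer_le hf hcont hb hν (tikhonovMinimizer f μ)
    unfold tikhonov at h1 h2
    nlinarith
  · simpa [tikhonovBias, hμ] using tikhonovBias_nonneg hf hcont hne ν

/-- The regularized gradient points away from the minimum-norm minimizer, up to the bias. -/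
theorem le_inner_gradient_add_smul (hf : ConvexOn ℝ Set.univ f) (hdiff : Differentiable ℝ f)
    (hne : (argminSet f).Nonempty) {μ : ℝ} (hμ : 0 ≤ μ) (x : H) :
    μ / 2 * ‖x - minNormMinimizer f‖ ^ 2 - μ / 2 * tikhonovBias f μ
      ≤ inner ℝ (∇ f x + μ • x) (x - minNormMinimizer f) := by
  set z := minNormMinimizer f
  have hz : ∀ y, f z ≤ f y :=
    isMinOn_univ_iff.1 (minNormMinimizer_spec hf hdiff.continuous hne).1
  -- Convexity of `f` and the exact expansion of the quadratic bound the inner product below by `f_μ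
  -- x - f_μ z + μ / 2 * ‖x - z‖ ^ 2`. Then `f_μ x ≥ f_μ x_μ ≥ f z + μ / 2 * ‖x_μ‖ ^ 2`.
  have h1 := hf.add_inner_gradient_le (hdiff x) z
  have h2 : inner ℝ (∇ f x) (z - x) = - inner ℝ (∇ f x) (x - z) := by
    rw [← neg_sub, inner_neg_right]
  rw [inner_add_left, real_inner_smul_left, inner_sub_right x, real_inner_self_eq_norm_sq,
    norm_sub_sq_real]
  rcases hμ.eq_or_lt with rfl | hpos
  · simp only [zero_div, zero_mul, sub_zero, add_zero]
    linarith [hz x]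
  have h3 := tikhonovMinimizer_le hf hdiff.continuous
    (bddBelow_range_of_argminSet_nonempty hne) hpos x
  have h4 := hz (tikhonovMinimizer f μ)
  simp only [tikhonovBias, hpos, if_true]
  unfold tikhonov at h3
  change _ - μ / 2 * (‖z‖ ^ 2 - _) ≤ _
  linarith

theorem norm_gradient_le (hf : ConvexOn ℝ Set.univ f) (hcont : Continuous f) {L : ℝ≥0}
    (hL : LipschitzWith L (∇ f)) (hne : (argminSet f).Nonempty) (x : H) :
    ‖∇ f x‖ ≤ L * ‖x - minNormMinimizer f‖ := by
  have h0 : ∇ f (minNormMinimizer f) = 0 := by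
    have := ((minNormMinimizer_spec hf hcont hne).1.isLocalMin univ_mem).fderiv_eq_zero
    simp [gradient, this]
  simpa [h0, dist_eq_norm] using hL.dist_le_mul x (minNormMinimizer f)

theorem sub_minNormMinimizer_le (hf : ConvexOn ℝ Set.univ f) (hdiff : Differentiable ℝ f)
    {L : ℝ≥0} (hL : LipschitzWith L (∇ f)) (hne : (argminSet f).Nonempty) (x : H) :
    f x - f (minNormMinimizer f) ≤ L * ‖x - minNormMinimizer f‖ ^ 2 := by
  have h1 := hf.add_inner_gradient_le (hdiff x) (minNormMinimizer f)
  have h2 := neg_le_of_abs_le (abs_real_inner_le_norm (∇ f x) (minNormMinimizer f - x))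
  have h3 := norm_gradient_le hf hdiff.continuous hL hne x
  rw [norm_sub_rev] at h2
  nlinarith [norm_nonneg (x - minNormMinimizer f)]

end Deterministic

/-! ### Almost supermartingales -/

section RobbinsSiegmund

/-- The normalizing weight of the Robbins–Siegmund theorem: the inverse of `∏ (1 + β j)`, set to
zero once the partial sums of `η` exceed `M`. -/
noncomputable def rsWeight (β η : ℕ → ℝ) (M : ℝ) (n : ℕ) : ℝ :=
  if ∑ j ∈ Finset.range n, η j ≤ M then ∏ j ∈ Finset.range n, (1 + β j)⁻¹ else 0

section Weight

variable {β η : ℕ → ℝ} {M : ℝ}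

theorem prod_inv_one_add_nonneg (hβ : ∀ n, 0 ≤ β n) (n : ℕ) :
    0 ≤ ∏ j ∈ Finset.range n, (1 + β j)⁻¹ :=
  Finset.prod_nonneg fun j _ => inv_nonneg.2 (by linarith [hβ j])

theorem prod_inv_one_add_le_one (hβ : ∀ n, 0 ≤ β n) (n : ℕ) :
    ∏ j ∈ Finset.range n, (1 + β j)⁻¹ ≤ 1 :=
  Finset.prod_le_one (fun j _ => inv_nonneg.2 (by linarith [hβ j]))
    fun j _ => inv_le_one_of_one_le₀ (by linarith [hβ j])

theorem rsWeight_nonneg (hβ : ∀ n, 0 ≤ β n) (n : ℕ) : 0 ≤ rsWeight β η M n := by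
  unfold rsWeight
  split_ifs
  exacts [prod_inv_one_add_nonneg hβ n, le_rfl]

theorem rsWeight_le_one (hβ : ∀ n, 0 ≤ β n) (n : ℕ) : rsWeight β η M n ≤ 1 := by
  unfold rsWeight
  split_ifs
  exacts [prod_inv_one_add_le_one hβ n, zero_le_one]

theorem rsWeight_succ_mul_le (hβ : ∀ n, 0 ≤ β n) (hη : ∀ n, 0 ≤ η n) (n : ℕ) :
    rsWeight β η M (n + 1) * (1 + β n) ≤ rsWeight β η M n := by
  by_cases h : ∑ j ∈ Finset.range (n + 1), η j ≤ M
  · have h' : ∑ j ∈ Finset.range n, η j ≤ M := by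
      rw [Finset.sum_range_succ] at h
      linarith [hη n]
    have : (1 + β n) ≠ 0 := by linarith [hβ n]
    simp only [rsWeight, h, h', if_true, Finset.prod_range_succ]
    rw [mul_assoc, inv_mul_cancel₀ this, mul_one]
  · simpa [rsWeight, h] using rsWeight_nonneg (η := η) (M := M) hβ n

/-- The weight at `k + 1` already sees `η k`, so the very term that pushes the partial sum above `M`
has weight zero. -/
theorem sum_rsWeight_mul_le (hβ : ∀ n, 0 ≤ β n) (hη : ∀ n, 0 ≤ η n) (hM : 0 ≤ M) (n : ℕ) :
    ∑ k ∈ Finset.range n, rsWeight β η M (k + 1) * η k ≤ M := by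
  induction n with
  | zero => simpa
  | succ n ih =>
    by_cases h : ∑ j ∈ Finset.range (n + 1), η j ≤ M
    · refine le_trans (Finset.sum_le_sum fun k _ => ?_) h
      exact mul_le_of_le_one_left (hη k) (rsWeight_le_one hβ _)
    · rw [Finset.sum_range_succ]
      simpa [rsWeight, h] using ih

/-- Pathwise part of the Robbins–Siegmund theorem. -/
theorem exists_tendsto_and_summable_of_rsWeight {V γ : ℕ → ℝ} {c : ℝ}
    (hV : ∀ n, 0 ≤ V n) (hβ : ∀ n, 0 ≤ β n) (hγ : ∀ n, 0 ≤ γ n) (hη : ∀ n, 0 ≤ η n)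
    (hβs : Summable β) (hηs : Summable η) (hM : ∑' n, η n ≤ M)
    (hY : Tendsto (fun n => rsWeight β η M n * V n +
      ∑ k ∈ Finset.range n, rsWeight β η M (k + 1) * (γ k - η k)) atTop (𝓝 c)) :
    (∃ v, Tendsto V atTop (𝓝 v)) ∧ Summable γ := by
  set p : ℕ → ℝ := fun n => ∏ j ∈ Finset.range n, (1 + β j)⁻¹ with hp
  -- Since `M` dominates the whole series, the truncation is never active on this path.
  have hw : ∀ n, rsWeight β η M n = p n := fun n => by
    simp [rsWeight, hp, (hηs.sum_le_tsum _ fun k _ => hη k).trans hM]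
  simp only [hw] at hY
  have hp0 : ∀ n, 0 ≤ p n := prod_inv_one_add_nonneg hβ
  have hp1 : ∀ n, p n ≤ 1 := prod_inv_one_add_le_one hβ
  set δ := Real.exp (-∑' n, β n)
  have hδ : 0 < δ := Real.exp_pos _
  -- `1 + β j ≤ exp (β j)` keeps the weights away from zero, so they can be divided out in the
  -- limit.
  have hpδ : ∀ n, δ ≤ p n := fun n => by
    calc δ ≤ Real.exp (-∑ j ∈ Finset.range n, β j) :=
          Real.exp_le_exp.2 (neg_le_neg (hβs.sum_le_tsum _ fun k _ => hβ k))
      _ = ∏ j ∈ Finset.range n, (Real.exp (β j))⁻¹ := by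
          rw [← Finset.sum_neg_distrib, Real.exp_sum]
          simp [Real.exp_neg]
      _ ≤ p n := Finset.prod_le_prod (fun j _ => by positivity) fun j _ =>
          inv_anti₀ (by linarith [hβ j]) (by linarith [Real.add_one_le_exp (β j)])
  have hpanti : Antitone p := antitone_nat_of_succ_le fun n => by
    simp only [hp, Finset.prod_range_succ]
    exact mul_le_of_le_one_right (hp0 n) (inv_le_one_of_one_le₀ (by linarith [hβ n]))
  have hplim := tendsto_atTop_ciInf hpanti ⟨0, Set.forall_mem_range.2 hp0⟩
  set q := ⨅ n, p n
  have hq : 0 < q := hδ.trans_le (le_ciInf hpδ)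
  have hpη : Summable fun k => p (k + 1) * η k :=
    Summable.of_nonneg_of_le (fun k => mul_nonneg (hp0 _) (hη k))
      (fun k => mul_le_of_le_one_left (hη k) (hp1 _)) hηs
  have hZ : Tendsto (fun n => p n * V n + ∑ k ∈ Finset.range n, p (k + 1) * γ k) atTop
      (𝓝 (c + ∑' k, p (k + 1) * η k)) := by
    refine (hY.add hpη.hasSum.tendsto_sum_nat).congr fun n => ?_
    simp only [mul_sub, Finset.sum_sub_distrib]
    ring
  have hpγ : Summable fun k => p (k + 1) * γ k := by
    obtain ⟨b, hb⟩ := hZ.bddAbove_range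
    refine summable_of_sum_range_le (c := b) (fun k => mul_nonneg (hp0 _) (hγ k)) fun n => ?_
    have := hb (Set.mem_range_self n)
    have h0 := mul_nonneg (hp0 n) (hV n)
    linarith
  refine ⟨⟨_, ((hZ.sub hpγ.hasSum.tendsto_sum_nat).div hplim hq.ne').congr fun n => ?_⟩, ?_⟩
  · have : p n ≠ 0 := (hδ.trans_le (hpδ n)).ne'
    simp only [Pi.div_apply, add_sub_cancel_right]
    field_simp
  · refine Summable.of_nonneg_of_le hγ (fun k => ?_) (hpγ.mul_left δ⁻¹)
    rw [← div_eq_inv_mul, le_div_iff₀ hδ, mul_comm]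
    exact mul_le_mul_of_nonneg_right (hpδ _) (hγ k)

end Weight

variable {Ω : Type*} {mΩ : MeasurableSpace Ω} {P : Measure Ω} {ℱ : Filtration ℕ mΩ}
  {V β γ η : ℕ → Ω → ℝ}

/-- The weight is predictable: at `n + 1` it involves only indices `j ≤ n`. Hence it can be pulled
out of `P[V (n + 1) | ℱ n]`. -/
theorem stronglyMeasurable_rsWeight_succ (hβm : ∀ n, StronglyMeasurable[ℱ n] (β n))
    (hηm : ∀ n, StronglyMeasurable[ℱ n] (η n)) (M : ℝ) (n : ℕ) :
    StronglyMeasurable[ℱ n] fun ω => rsWeight (β · ω) (η · ω) M (n + 1) := by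
  have hle : ∀ j ∈ Finset.range (n + 1), ℱ j ≤ ℱ n := fun j hj =>
    ℱ.mono (Finset.mem_range_succ_iff.1 hj)
  have h1 : Measurable[ℱ n] fun ω => ∑ j ∈ Finset.range (n + 1), η j ω :=
    Finset.measurable_sum _ fun j hj => (hηm j).measurable.mono (hle j hj) le_rfl
  have h2 : Measurable[ℱ n] fun ω => ∏ j ∈ Finset.range (n + 1), (1 + β j ω)⁻¹ :=
    Finset.measurable_prod _ fun j hj =>
      (((hβm j).measurable.mono (hle j hj) le_rfl).const_add 1).inv
  exact (Measurable.ite (measurableSet_le h1 measurable_const) h2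
    measurable_const).stronglyMeasurable

theorem stronglyMeasurable_rsWeight (hβm : ∀ n, StronglyMeasurable[ℱ n] (β n))
    (hηm : ∀ n, StronglyMeasurable[ℱ n] (η n)) (M : ℝ) (n : ℕ) :
    StronglyMeasurable[ℱ n] fun ω => rsWeight (β · ω) (η · ω) M n := by
  cases n with
  | zero => simpa [rsWeight] using stronglyMeasurable_const
  | succ n => exact (stronglyMeasurable_rsWeight_succ hβm hηm M n).mono (ℱ.mono n.le_succ)

/-- **Robbins–Siegmund theorem** for almost supermartingales. -/
theorem robbins_siegmund [IsFiniteMeasure P]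
    (hVm : ∀ n, StronglyMeasurable[ℱ n] (V n)) (hβm : ∀ n, StronglyMeasurable[ℱ n] (β n))
    (hγm : ∀ n, StronglyMeasurable[ℱ n] (γ n)) (hηm : ∀ n, StronglyMeasurable[ℱ n] (η n))
    (hV : ∀ n ω, 0 ≤ V n ω) (hβ : ∀ n ω, 0 ≤ β n ω) (hγ : ∀ n ω, 0 ≤ γ n ω)
    (hη : ∀ n ω, 0 ≤ η n ω)
    (hVi : ∀ n, Integrable (V n) P) (hγi : ∀ n, Integrable (γ n) P)
    (hcond : ∀ n, ∀ᵐ ω ∂P, (P[V (n + 1) | ℱ n]) ω ≤ (1 + β n ω) * V n ω - γ n ω + η n ω)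
    (hβs : ∀ᵐ ω ∂P, Summable (β · ω)) (hηs : ∀ᵐ ω ∂P, Summable (η · ω)) :
    ∀ᵐ ω ∂P, (∃ v, Tendsto (V · ω) atTop (𝓝 v)) ∧ Summable (γ · ω) := by
  set w : ℝ → ℕ → Ω → ℝ := fun M n ω => rsWeight (β · ω) (η · ω) M n with hw
  have hw0 : ∀ M n ω, 0 ≤ w M n ω := fun M n ω => rsWeight_nonneg (hβ · ω) n
  have hw1 : ∀ M n ω, w M n ω ≤ 1 := fun M n ω => rsWeight_le_one (hβ · ω) n
  have hwm : ∀ M n, StronglyMeasurable[ℱ n] (w M n) := stronglyMeasurable_rsWeight hβm hηm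
  have hwm' : ∀ M n, StronglyMeasurable[ℱ n] (w M (n + 1)) :=
    stronglyMeasurable_rsWeight_succ hβm hηm
  have hwi : ∀ M n {g : Ω → ℝ}, Integrable g P → Integrable (w M n * g) P := fun M n g hg =>
    hg.bdd_mul ((hwm M n).mono (ℱ.le n)).aestronglyMeasurable (c := 1)
      (ae_of_all _ fun ω => by rw [Real.norm_of_nonneg (hw0 M n ω)]; exact hw1 M n ω)
  set R : ℝ → ℕ → Ω → ℝ := fun M n => ∑ k ∈ Finset.range n, w M (k + 1) * (γ k - η k) with hR
  -- Natural `M` suffice: a countable union of null sets is null, and almost every path has `∑ η`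
  -- below some such `M`.
  have key : ∀ M : ℕ, ∀ᵐ ω ∂P, ∃ c, Tendsto (fun n => (w M n * V n + R M n) ω) atTop (𝓝 c) := by
    intro M
    have hM : (0 : ℝ) ≤ M := Nat.cast_nonneg M
    have hsum : ∀ n ω, ∑ k ∈ Finset.range n, w M (k + 1) ω * η k ω ≤ M := fun n ω =>
      sum_rsWeight_mul_le (hβ · ω) (hη · ω) hM n
    -- `η k` itself is not assumed integrable; the truncation bounds the weighted term by `M`.
    have hηi : ∀ k, Integrable (w M (k + 1) * η k) P := fun k => by
      refine Integrable.of_bound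
        (((hwm' M k).mul (hηm k)).mono (ℱ.le k)).aestronglyMeasurable (M : ℝ)
        (ae_of_all _ fun ω => ?_)
      rw [Pi.mul_apply, Real.norm_of_nonneg (mul_nonneg (hw0 _ _ _) (hη _ _))]
      refine le_trans ?_ (hsum (k + 1) ω)
      exact Finset.single_le_sum (f := fun k => w M (k + 1) ω * η k ω)
        (fun j _ => mul_nonneg (hw0 _ _ _) (hη _ _)) (Finset.self_mem_range_succ k)
    have hRi : ∀ n, Integrable (R M n) P := fun n => integrable_finsetSum' _ fun k _ => by
      rw [mul_sub]
      exact (hwi M (k + 1) (hγi k)).sub (hηi k)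
    have hRm' : ∀ n, StronglyMeasurable[ℱ n] (R M (n + 1)) := fun n =>
      Finset.stronglyMeasurable_sum _ fun k hk =>
        ((hwm' M k).mul ((hγm k).sub (hηm k))).mono (ℱ.mono (Finset.mem_range_succ_iff.1 hk))
    have hRm : ∀ n, StronglyMeasurable[ℱ n] (R M n) := fun n => by
      cases n with
      | zero => simpa [hR] using stronglyMeasurable_zero
      | succ n => exact (hRm' n).mono (ℱ.mono n.le_succ)
    have hYi : ∀ n, Integrable (w M n * V n + R M n) P := fun n => (hwi M n (hVi n)).add (hRi n)
    have hsuper : Supermartingale (fun n => w M n * V n + R M n) ℱ P := by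
      refine supermartingale_nat (fun n => ((hwm M n).mul (hVm n)).add (hRm n)) hYi fun n => ?_
      have h1 := condExp_add (hwi M (n + 1) (hVi (n + 1))) (hRi (n + 1)) (ℱ n)
      have h2 := condExp_mul_of_stronglyMeasurable_left (hwm' M n)
        (hwi M (n + 1) (hVi (n + 1))) (hVi (n + 1))
      have h3 := condExp_of_stronglyMeasurable (ℱ.le n) (hRm' n) (hRi (n + 1))
      filter_upwards [h1, h2, hcond n] with ω h1 h2 hc
      rw [h1, Pi.add_apply, h2, h3]
      simp only [Pi.mul_apply, Pi.add_apply, hR, Finset.sum_range_succ, Pi.sub_apply]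
      have h4 : w M (n + 1) ω * (1 + β n ω) ≤ w M n ω :=
        rsWeight_succ_mul_le (hβ · ω) (hη · ω) n
      have h5 := mul_le_mul_of_nonneg_left hc (hw0 M (n + 1) ω)
      have h6 := mul_le_mul_of_nonneg_right h4 (hV n ω)
      linarith
    have hlow : ∀ n ω, -(M : ℝ) ≤ (w M n * V n + R M n) ω := fun n ω => by
      have h1 := mul_nonneg (hw0 M n ω) (hV n ω)
      have h2 := hsum n ω
      have h3 : 0 ≤ ∑ k ∈ Finset.range n, w M (k + 1) ω * γ k ω :=
        Finset.sum_nonneg fun k _ => mul_nonneg (hw0 _ _ _) (hγ _ _)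
      simp only [hR, Pi.add_apply, Pi.mul_apply, Finset.sum_apply, Pi.sub_apply, mul_sub,
        Finset.sum_sub_distrib]
      linarith
    -- From `Y ≥ -M` follows `|Y| ≤ Y + 2 M`, and the expectation of the supermartingale `Y` is at
    -- most its initial value.
    have hbdd : ∀ n, eLpNorm (-(w M n * V n + R M n)) 1 P ≤
        ((∫ ω, ((w M 0 * V 0 + R M 0) ω + 2 * M) ∂P).toNNReal : ℝ≥0) := fun n => by
      rw [eLpNorm_neg, eLpNorm_one_eq_lintegral_enorm,
        ← ofReal_integral_norm_eq_lintegral_enorm (hYi n)]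
      refine ENNReal.ofReal_le_ofReal ?_
      calc ∫ ω, ‖(w M n * V n + R M n) ω‖ ∂P
          ≤ ∫ ω, ((w M n * V n + R M n) ω + 2 * M) ∂P := by
            refine integral_mono (hYi n).norm ((hYi n).add (integrable_const _)) fun ω => ?_
            exact abs_le.2 ⟨by linarith [hlow n ω], by linarith⟩
        _ ≤ _ := by
            rw [integral_add (hYi n) (integrable_const _),
              integral_add (hYi 0) (integrable_const _)]
            have := hsuper.setIntegral_le (Nat.zero_le n) MeasurableSet.univ
            simp only [setIntegral_univ] at this
            linarith
    filter_upwards [hsuper.neg.exists_ae_tendsto_of_bdd hbdd] with ω hω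
    obtain ⟨c, hc⟩ := hω
    exact ⟨-c, by simpa using hc.neg⟩
  filter_upwards [ae_all_iff.2 key, hβs, hηs] with ω hω hβω hηω
  obtain ⟨M, hM⟩ := exists_nat_ge (∑' n, η n ω)
  obtain ⟨c, hc⟩ := hω M
  refine exists_tendsto_and_summable_of_rsWeight (hV · ω) (hβ · ω) (hγ · ω) (hη · ω) hβω hηω hM
    (c := c) ?_
  simpa [hR, hw] using hc

end RobbinsSiegmund

/-! ### Conditional second moments and a summability argument -/

section Stochastic

variable {H : Type*} [NormedAddCommGroup H] [InnerProductSpace ℝ H]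
  {Ω : Type*} {mΩ : MeasurableSpace Ω} {P : Measure Ω}

theorem MeasureTheory.MemLp.ae_bdd_smul {p : ℝ≥0∞} {a : Ω → ℝ} {u : Ω → H} {c : ℝ}
    (hu : MemLp u p P) (ha : AEStronglyMeasurable a P) (hac : ∀ᵐ ω ∂P, ‖a ω‖ ≤ c) :
    MemLp (fun ω => a ω • u ω) p P := by
  refine MemLp.of_le_mul (c := c) hu (ha.smul hu.1) ?_
  filter_upwards [hac] with ω hω
  rw [norm_smul]
  gcongr

/-- Conditional bias-variance decomposition: `E[‖Z - a D‖² | m] = ‖Z‖² + a² E[‖D‖² | m]` for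
`m`-measurable `Z` and `a`, and noise `D` with `E[D | m] = 0`. -/
theorem condExp_norm_sub_smul_sq [CompleteSpace H] [IsFiniteMeasure P] {m : MeasurableSpace Ω}
    (hm : m ≤ mΩ) {Z D : Ω → H} {a : Ω → ℝ} {c : ℝ} (hZm : StronglyMeasurable[m] Z)
    (hZ : MemLp Z 2 P) (hD : MemLp D 2 P) (hD0 : P[D | m] =ᵐ[P] 0)
    (ham : StronglyMeasurable[m] a) (hac : ∀ᵐ ω ∂P, ‖a ω‖ ≤ c) :
    P[fun ω => ‖Z ω - a ω • D ω‖ ^ 2 | m] =ᵐ[P]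
      fun ω => ‖Z ω‖ ^ 2 + a ω ^ 2 * (P[fun ω => ‖D ω‖ ^ 2 | m]) ω := by
  -- `U` carries the cross term: it is `m`-measurable, so the conditional expectation of `⟪U, D⟫` is
  -- `⟪U, P[D | m]⟫ = 0`.
  set U : Ω → H := fun ω => (-2 : ℝ) • (a ω • Z ω) with hU
  have hU2 : MemLp U 2 P :=
    (hZ.ae_bdd_smul (ham.mono hm).aestronglyMeasurable hac).const_smul (-2 : ℝ)
  have hUm : StronglyMeasurable[m] U := (ham.smul hZm).const_smul (-2 : ℝ)
  have hZsq : Integrable (fun ω => ‖Z ω‖ ^ 2) P := hZ.integrable_norm_pow two_ne_zero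
  have hDsq : Integrable (fun ω => ‖D ω‖ ^ 2) P := hD.integrable_norm_pow two_ne_zero
  have hUD : Integrable (fun ω => innerSL ℝ (U ω) (D ω)) P := by
    refine Integrable.mono' (hU2.norm.integrable_mul hD.norm)
      (hU2.1.inner hD.1) (ae_of_all _ fun ω => ?_)
    exact norm_inner_le_norm (𝕜 := ℝ) _ _
  have haDsq : Integrable ((fun ω => a ω ^ 2) * fun ω => ‖D ω‖ ^ 2) P := by
    refine hDsq.bdd_mul (c := c ^ 2) ((ham.pow 2).mono hm).aestronglyMeasurable ?_
    filter_upwards [hac] with ω hω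
    rw [norm_pow]
    gcongr
  have hdecomp : (fun ω => ‖Z ω - a ω • D ω‖ ^ 2) =
      ((fun ω => ‖Z ω‖ ^ 2) + fun ω => innerSL ℝ (U ω) (D ω)) +
        (fun ω => a ω ^ 2) * fun ω => ‖D ω‖ ^ 2 := by
    ext ω
    simp only [hU, Pi.add_apply, Pi.mul_apply, innerSL_apply_apply, real_inner_smul_left]
    rw [norm_sub_sq_real, real_inner_smul_right, norm_smul, mul_pow, Real.norm_eq_abs, sq_abs]
    ring
  rw [hdecomp]
  have h1 := condExp_add (hZsq.add hUD) haDsq m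
  have h2 := condExp_add hZsq hUD m
  have h3 := condExp_bilin_of_stronglyMeasurable_left (innerSL ℝ) hUm hUD (hD.integrable one_le_two)
  have h4 : P[(fun ω => a ω ^ 2) * fun ω => ‖D ω‖ ^ 2 | m] =ᵐ[P]
      (fun ω => a ω ^ 2) * P[fun ω => ‖D ω‖ ^ 2 | m] :=
    condExp_mul_of_stronglyMeasurable_left (ham.pow 2) haDsq hDsq
  have h5 : P[fun ω => ‖Z ω‖ ^ 2 | m] = fun ω => ‖Z ω‖ ^ 2 :=
    condExp_of_stronglyMeasurable hm (hZm.norm.pow 2) hZsq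
  filter_upwards [h1, h2, h3, h4, hD0] with ω h1 h2 h3 h4 h0
  rw [h1, Pi.add_apply, h2, Pi.add_apply, h3, h4, h0, h5]
  simp

/-- Integrating the `[0, ∞]`-valued bound yields square integrability of `D`. Only then does the
real conditional expectation, which is `0` by default for non-integrable functions, agree with it.
-/
theorem memLp_two_and_condExp_le_of_condLExp_le {E : Type*} [NormedAddCommGroup E]
    [IsFiniteMeasure P] {m : MeasurableSpace Ω}
    (hm : m ≤ mΩ) {D : Ω → E} {B : Ω → ℝ} (hD : AEStronglyMeasurable[mΩ] D P) (hB : Integrable B P)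
    (hB0 : ∀ᵐ ω ∂P, 0 ≤ B ω)
    (h : ∀ᵐ ω ∂P, condLExp m P (fun ω' => ‖D ω'‖ₑ ^ 2) ω ≤ ENNReal.ofReal (B ω)) :
    MemLp D 2 P ∧ ∀ᵐ ω ∂P, (P[fun ω' => ‖D ω'‖ ^ 2 | m]) ω ≤ B ω := by
  have hfin : ∫⁻ ω, ‖D ω‖ₑ ^ 2 ∂P ≠ ∞ := by
    rw [← lintegral_condLExp hm]
    refine ((lintegral_mono_ae h).trans_lt ?_).ne
    rw [← ofReal_integral_eq_lintegral_ofReal hB hB0]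
    exact ENNReal.ofReal_lt_top
  refine ⟨(memLp_two_iff_integrable_sq_norm hD).2 ⟨hD.norm.pow 2, ?_⟩, ?_⟩
  · simpa [HasFiniteIntegral, enorm_pow] using hfin.lt_top
  · have h1 := toReal_condLExp m (hD.enorm.pow_const 2) hfin
    simp only [ENNReal.toReal_pow, toReal_enorm] at h1
    filter_upwards [h1, h, hB0] with ω h1 h2 h3
    rw [← h1]
    exact ENNReal.toReal_le_of_le_ofReal h3 h2

/-- A convergent nonnegative sequence that is summable against weights with divergent sum tends
to zero. -/
theorem tendsto_zero_of_summable_mul {a V : ℕ → ℝ} {v : ℝ} (hV : ∀ n, 0 ≤ V n)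
    (hv : Tendsto V atTop (𝓝 v))
    (hdiv : Tendsto (fun n => ∑ k ∈ Finset.range n, a k) atTop atTop)
    (hs : Summable fun k => |a k| * V k) : Tendsto V atTop (𝓝 0) := by
  have hv0 : 0 ≤ v := ge_of_tendsto' hv hV
  rcases hv0.eq_or_lt with rfl | hpos
  · exact hv
  -- If `v > 0` then eventually `V k ≥ v / 2`, so `|a k| ≤ 2 / v * (|a k| * V k)` would make `a`
  -- summable.
  refine absurd ?_ (not_tendsto_nhds_of_tendsto_atTop hdiv (∑' k, a k))
  refine (Summable.of_norm_bounded_eventually_nat (hs.mul_left (2 / v)) ?_).hasSum.tendsto_sum_nat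
  filter_upwards [hv.eventually_const_le (half_lt_self hpos)] with k hk
  rw [Real.norm_eq_abs]
  calc |a k| = 2 / v * (|a k| * (v / 2)) := by field_simp
    _ ≤ _ := by gcongr

end Stochastic

/-! ### One deterministic step -/

section Descent

variable {H : Type*} [NormedAddCommGroup H] [InnerProductSpace ℝ H] [CompleteSpace H]
  {f : H → ℝ} {L : ℝ≥0}

/-- One noiseless step of regularized gradient descent. -/
theorem norm_regularized_step_sq_le (hf : ConvexOn ℝ Set.univ f) (hdiff : Differentiable ℝ f)
    (hL : LipschitzWith L (∇ f)) (hne : (argminSet f).Nonempty) {a μ c : ℝ} (ha : 0 ≤ a)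
    (hμ : 0 ≤ μ) (hμc : μ ≤ c) (x : H) :
    ‖x - a • (∇ f x + μ • x) - minNormMinimizer f‖ ^ 2 ≤
      (1 + 2 * (L + c) ^ 2 * a ^ 2) * ‖x - minNormMinimizer f‖ ^ 2
        - a * μ * ‖x - minNormMinimizer f‖ ^ 2
        + (a * μ * tikhonovBias f μ + 2 * c ^ 2 * ‖minNormMinimizer f‖ ^ 2 * a ^ 2) := by
  have h1 := le_inner_gradient_add_smul hf hdiff hne hμ x
  have h2 := norm_gradient_le hf hdiff.continuous hL hne x
  set z := minNormMinimizer f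
  set g := ∇ f x + μ • x
  have hx : ‖x‖ ≤ ‖x - z‖ + ‖z‖ := by simpa using norm_add_le (x - z) z
  have hg : ‖g‖ ≤ (L + c) * ‖x - z‖ + c * ‖z‖ := by
    calc ‖g‖ ≤ ‖∇ f x‖ + μ * ‖x‖ := by
          refine (norm_add_le _ _).trans_eq ?_
          rw [norm_smul, Real.norm_of_nonneg hμ]
      _ ≤ L * ‖x - z‖ + c * (‖x - z‖ + ‖z‖) :=
          add_le_add h2 (mul_le_mul hμc hx (norm_nonneg _) (hμ.trans hμc))
      _ = _ := by ring
  have hg2 : ‖g‖ ^ 2 ≤ 2 * (L + c) ^ 2 * ‖x - z‖ ^ 2 + 2 * c ^ 2 * ‖z‖ ^ 2 := by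
    have h3 := pow_le_pow_left₀ (norm_nonneg g) hg 2
    linarith [add_sq_le (a := (L + c) * ‖x - z‖) (b := c * ‖z‖),
      mul_pow ((L : ℝ) + c) ‖x - z‖ 2, mul_pow c ‖z‖ 2]
  have h4 : x - a • g - z = (x - z) - a • g := by abel
  rw [h4, norm_sub_sq_real, real_inner_smul_right, norm_smul, mul_pow, Real.norm_eq_abs, sq_abs,
    real_inner_comm]
  -- The factor `2` of the cross term cancels the halves in `h1`, leaving `a * μ`.
  have h5 := mul_le_mul_of_nonneg_left h1 ha
  have h6 := mul_le_mul_of_nonneg_left hg2 (sq_nonneg a)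
  linarith

end Descent

/-! ### The stochastic recursion -/

section RegSGD

variable {H : Type*} [NormedAddCommGroup H] [InnerProductSpace ℝ H] [CompleteSpace H]
  {Ω : Type*} {mΩ : MeasurableSpace Ω} {P : Measure Ω}
  {ℱ : Filtration ℕ mΩ} {f : H → ℝ} {L : ℝ≥0} {α lam : ℕ → Ω → ℝ} {D X : ℕ → Ω → H}
  {A C a c : ℝ}

/-- The noiseless step `X_k - α_{k+1} (∇f(X_k) + lam_{k+1} X_k) - x_*`. -/
noncomputable def noiselessError (f : H → ℝ) (α lam : ℕ → Ω → ℝ) (X : ℕ → Ω → H) (k : ℕ) (ω : Ω) :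
    H :=
  X k ω - α (k + 1) ω • (∇ f (X k ω) + lam (k + 1) ω • X k ω) - minNormMinimizer f

theorem stronglyMeasurable_noiselessError (hL : LipschitzWith L (∇ f))
    (hX : IsRegSGD P ℱ f α lam D X) (hα_pred : ∀ k, StronglyMeasurable[ℱ k] (α (k + 1)))
    (hlam_pred : ∀ k, StronglyMeasurable[ℱ k] (lam (k + 1))) (k : ℕ) :
    StronglyMeasurable[ℱ k] (noiselessError f α lam X k) :=
  ((hX.adapted k).sub ((hα_pred k).smul ((hL.continuous.comp_stronglyMeasurable (hX.adapted k)).add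
    ((hlam_pred k).smul (hX.adapted k))))).sub stronglyMeasurable_const

theorem IsRegSGD.sub_minNormMinimizer_ae_eq (hX : IsRegSGD P ℱ f α lam D X) (k : ℕ) :
    ∀ᵐ ω ∂P, X (k + 1) ω - minNormMinimizer f =
      noiselessError f α lam X k ω - α (k + 1) ω • D (k + 1) ω := by
  filter_upwards [hX.recursion] with ω hω
  rw [hω k, noiselessError, smul_add _ (_ + _)]
  abel

variable [IsProbabilityMeasure P]

theorem memLp_noiselessError (hf : ConvexOn ℝ Set.univ f) (hdiff : Differentiable ℝ f)
    (hL : LipschitzWith L (∇ f)) (hne : (argminSet f).Nonempty)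
    (hα_pred : ∀ k, StronglyMeasurable[ℱ k] (α (k + 1)))
    (hlam_pred : ∀ k, StronglyMeasurable[ℱ k] (lam (k + 1)))
    {k : ℕ} (hα : ∀ᵐ ω ∂P, ‖α (k + 1) ω‖ ≤ a) (hlam : ∀ᵐ ω ∂P, ‖lam (k + 1) ω‖ ≤ c)
    (hXk : MemLp (X k) 2 P) : MemLp (noiselessError f α lam X k) 2 P := by
  have hc : MemLp (fun _ : Ω => minNormMinimizer f) 2 P := memLp_const _
  have hg : MemLp (fun ω => ∇ f (X k ω)) 2 P :=
    MemLp.of_le_mul (c := (L : ℝ)) (hXk.sub hc)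
      (hL.continuous.comp_aestronglyMeasurable hXk.1)
      (ae_of_all _ fun ω => norm_gradient_le hf hdiff.continuous hL hne (X k ω))
  have hl := hXk.ae_bdd_smul ((hlam_pred k).mono (ℱ.le k)).aestronglyMeasurable hlam
  have hα' := (hg.add hl).ae_bdd_smul ((hα_pred k).mono (ℱ.le k)).aestronglyMeasurable hα
  exact (hXk.sub hα').sub hc

theorem integrable_sub_minNormMinimizer (hf : ConvexOn ℝ Set.univ f) (hdiff : Differentiable ℝ f)
    (hL : LipschitzWith L (∇ f)) (hne : (argminSet f).Nonempty) {Y : Ω → H} (hY : MemLp Y 2 P) :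
    Integrable (fun ω => f (Y ω) - f (minNormMinimizer f)) P := by
  have hsq : Integrable (fun ω => ‖Y ω - minNormMinimizer f‖ ^ 2) P :=
    (hY.sub (memLp_const (minNormMinimizer f))).integrable_norm_pow two_ne_zero
  refine (hsq.const_mul (L : ℝ)).mono'
    ((hdiff.continuous.comp_aestronglyMeasurable hY.1).sub aestronglyMeasurable_const)
    (ae_of_all _ fun ω => ?_)
  rw [Real.norm_of_nonneg (sub_nonneg.2 (isMinOn_univ_iff.1
    (minNormMinimizer_spec hf hdiff.continuous hne).1 _))]
  exact sub_minNormMinimizer_le hf hdiff hL hne _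

theorem IsRegSGD.noise_bounds (hX : IsRegSGD P ℱ f α lam D X)
    (hf : ConvexOn ℝ Set.univ f) (hdiff : Differentiable ℝ f)
    (hL : LipschitzWith L (∇ f)) (hne : (argminSet f).Nonempty) (hA : 0 ≤ A) (hC : 0 ≤ C)
    (hABC : ABCCondition P ℱ f A C D X) {k : ℕ} (hXk : MemLp (X k) 2 P) :
    MemLp (D (k + 1)) 2 P ∧ ∀ᵐ ω ∂P, (P[fun ω' => ‖D (k + 1) ω'‖ ^ 2 | ℱ k]) ω ≤
      A * (f (X k ω) - f (minNormMinimizer f)) + C :=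
  memLp_two_and_condExp_le_of_condLExp_le (ℱ.le k) (hX.noise_integrable k).1
    (((integrable_sub_minNormMinimizer hf hdiff hL hne hXk).const_mul A).add (integrable_const C))
    (ae_of_all _ fun _ => add_nonneg (mul_nonneg hA (sub_nonneg.2 (isMinOn_univ_iff.1
      (minNormMinimizer_spec hf hdiff.continuous hne).1 _))) hC) (hABC k)

/-- Induction is forced: the ABC bound on `D (k + 1)` is integrable only once `X k` is square
integrable, through the quadratic growth of `f`. -/
theorem IsRegSGD.memLp_two (hX : IsRegSGD P ℱ f α lam D X)
    (hf : ConvexOn ℝ Set.univ f) (hdiff : Differentiable ℝ f)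
    (hL : LipschitzWith L (∇ f)) (hne : (argminSet f).Nonempty) (hA : 0 ≤ A) (hC : 0 ≤ C)
    (hABC : ABCCondition P ℱ f A C D X)
    (hα_pred : ∀ k, StronglyMeasurable[ℱ k] (α (k + 1)))
    (hlam_pred : ∀ k, StronglyMeasurable[ℱ k] (lam (k + 1)))
    (hα : ∀ k, ∀ᵐ ω ∂P, ‖α (k + 1) ω‖ ≤ a) (hlam : ∀ k, ∀ᵐ ω ∂P, ‖lam (k + 1) ω‖ ≤ c) (k : ℕ) :
    MemLp (X k) 2 P := by
  induction k with
  | zero => exact hX.memLp_zero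
  | succ k ih =>
    have h1 := memLp_noiselessError hf hdiff hL hne hα_pred hlam_pred (hα k) (hlam k) ih
    have h2 := (hX.noise_bounds hf hdiff hL hne hA hC hABC ih).1.ae_bdd_smul
      ((hα_pred k).mono (ℱ.le k)).aestronglyMeasurable (hα k)
    refine ((h1.sub h2).add (memLp_const (minNormMinimizer f))).ae_eq ?_
    filter_upwards [hX.sub_minNormMinimizer_ae_eq k] with ω hω
    simp only [Pi.add_apply, Pi.sub_apply]
    rw [← hω, sub_add_cancel]

/-- The form required by `robbins_siegmund`. The absolute values make the coefficients nonnegative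
at every `ω`, whereas `α` and `lam` are so only almost surely. The term `A * L` is the
state-dependent part of the noise variance. -/
theorem IsRegSGD.condExp_le (hX : IsRegSGD P ℱ f α lam D X)
    (hf : ConvexOn ℝ Set.univ f) (hdiff : Differentiable ℝ f)
    (hL : LipschitzWith L (∇ f)) (hne : (argminSet f).Nonempty) (hA : 0 ≤ A) (hC : 0 ≤ C)
    (hABC : ABCCondition P ℱ f A C D X)
    (hα_pred : ∀ k, StronglyMeasurable[ℱ k] (α (k + 1)))
    (hlam_pred : ∀ k, StronglyMeasurable[ℱ k] (lam (k + 1)))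
    (hα : ∀ k, ∀ᵐ ω ∂P, ‖α (k + 1) ω‖ ≤ a) (hlam : ∀ k, ∀ᵐ ω ∂P, ‖lam (k + 1) ω‖ ≤ c) (k : ℕ) :
    ∀ᵐ ω ∂P, (P[fun ω' => ‖X (k + 1) ω' - minNormMinimizer f‖ ^ 2 | ℱ k]) ω ≤
      (1 + (2 * (L + c) ^ 2 + A * L) * α (k + 1) ω ^ 2) * ‖X k ω - minNormMinimizer f‖ ^ 2
        - |α (k + 1) ω * lam (k + 1) ω| * ‖X k ω - minNormMinimizer f‖ ^ 2
        + (|α (k + 1) ω * lam (k + 1) ω| * tikhonovBias f (lam (k + 1) ω)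
          + (2 * c ^ 2 * ‖minNormMinimizer f‖ ^ 2 + C) * α (k + 1) ω ^ 2) := by
  have hXk := hX.memLp_two hf hdiff hL hne hA hC hABC hα_pred hlam_pred hα hlam k
  obtain ⟨hD, hDle⟩ := hX.noise_bounds hf hdiff hL hne hA hC hABC hXk
  have hcongr : (fun ω => ‖X (k + 1) ω - minNormMinimizer f‖ ^ 2) =ᵐ[P]
      fun ω => ‖noiselessError f α lam X k ω - α (k + 1) ω • D (k + 1) ω‖ ^ 2 := by
    filter_upwards [hX.sub_minNormMinimizer_ae_eq k] with ω hω
    rw [hω]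
  filter_upwards [condExp_congr_ae (m := ℱ k) hcongr, hDle, hX.step_nonneg, hX.reg_nonneg, hlam k,
    condExp_norm_sub_smul_sq (ℱ.le k)
      (stronglyMeasurable_noiselessError hL hX hα_pred hlam_pred k)
      (memLp_noiselessError hf hdiff hL hne hα_pred hlam_pred (hα k) (hlam k) hXk) hD
      (hX.noise_condExp k) (hα_pred k) (hα k)] with ω h1 h2 h3 h4 h5 h6
  rw [h1, h6, abs_of_nonneg (mul_nonneg (h3 k) (h4 k))]
  have h7 := norm_regularized_step_sq_le hf hdiff hL hne (h3 k) (h4 k)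
    ((le_abs_self _).trans h5) (X k ω)
  have h8 := mul_le_mul_of_nonneg_left (sub_minNormMinimizer_le hf hdiff hL hne (X k ω)) hA
  have h9 := mul_le_mul_of_nonneg_left h2 (sq_nonneg (α (k + 1) ω))
  have h10 := mul_le_mul_of_nonneg_left h8 (sq_nonneg (α (k + 1) ω))
  simp only [noiselessError]
  linarith

end RegSGD

/-! ### Conclusion -/

theorem theorem1
    {H : Type*} [NormedAddCommGroup H] [InnerProductSpace ℝ H] [CompleteSpace H]
    [TopologicalSpace.SeparableSpace H]
    {Ω : Type*} {mΩ : MeasurableSpace Ω} (P : Measure Ω) [IsProbabilityMeasure P]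
    (ℱ : Filtration ℕ mΩ)
    -- the objective function: convex, differentiable, with `L`-Lipschitz gradient and a minimizer
    (f : H → ℝ) (L : ℝ≥0)
    (hf_convex : ConvexOn ℝ Set.univ f) (hf_diff : Differentiable ℝ f)
    (hf_smooth : LipschitzWith L (∇ f)) (hf_argmin : (argminSet f).Nonempty)
    -- the regularized stochastic gradient descent scheme with noise of ABC type
    (α lam : ℕ → Ω → ℝ) (D X : ℕ → Ω → H)
    (hX : IsRegSGD P ℱ f α lam D X)
    (A C : ℝ) (hA : 0 ≤ A) (hC : 0 ≤ C) (hABC : ABCCondition P ℱ f A C D X)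
    -- predictable, uniformly bounded step-sizes and regularization parameters
    (hα_pred : ∀ k, StronglyMeasurable[ℱ k] (α (k + 1)))
    (hlam_pred : ∀ k, StronglyMeasurable[ℱ k] (lam (k + 1)))
    (hα_bdd : ∃ c : ℝ, ∀ᵐ ω ∂P, ∀ k, α (k + 1) ω ≤ c)
    (hlam_bdd : ∃ c : ℝ, ∀ᵐ ω ∂P, ∀ k, lam (k + 1) ω ≤ c)
    -- the regularization parameters decrease to zero
    (hlam_anti : ∀ᵐ ω ∂P, Antitone fun k => lam (k + 1) ω)
    (hlam_lim : ∀ᵐ ω ∂P, Tendsto (fun k => lam (k + 1) ω) atTop (𝓝 0))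
    -- the three summability conditions
    (h_sum_div : ∀ᵐ ω ∂P, Tendsto
      (fun n => ∑ k ∈ Finset.range n, α (k + 1) ω * lam (k + 1) ω) atTop atTop)
    (h_sum_sq : ∀ᵐ ω ∂P, Summable fun k => α (k + 1) ω ^ 2)
    (h_sum_bias : ∀ᵐ ω ∂P, Summable fun k => α (k + 1) ω * lam (k + 1) ω *
      (‖minNormMinimizer f‖ ^ 2 - ‖tikhonovMinimizer f (lam (k + 1) ω)‖ ^ 2)) :
    ∀ᵐ ω ∂P, Tendsto (fun k => X k ω) atTop (𝓝 (minNormMinimizer f)) := by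
  obtain ⟨a, ha⟩ := hα_bdd
  obtain ⟨c, hc⟩ := hlam_bdd
  have hα : ∀ k, ∀ᵐ ω ∂P, ‖α (k + 1) ω‖ ≤ a := fun k => by
    filter_upwards [ha, hX.step_nonneg] with ω h1 h2
    rw [Real.norm_of_nonneg (h2 k)]
    exact h1 k
  have hlam : ∀ k, ∀ᵐ ω ∂P, ‖lam (k + 1) ω‖ ≤ c := fun k => by
    filter_upwards [hc, hX.reg_nonneg] with ω h1 h2
    rw [Real.norm_of_nonneg (h2 k)]
    exact h1 k
  set z := minNormMinimizer f with hz
  have hb0 := tikhonovBias_nonneg hf_convex hf_diff.continuous hf_argmin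
  have hXm : ∀ k, StronglyMeasurable[ℱ k] fun ω => ‖X k ω - z‖ ^ 2 := fun k =>
    ((hX.adapted k).sub stronglyMeasurable_const).norm.pow 2
  have hαlam : ∀ k, StronglyMeasurable[ℱ k] fun ω => |α (k + 1) ω * lam (k + 1) ω| := fun k =>
    ((hα_pred k).mul (hlam_pred k)).norm
  have hbm : ∀ k, StronglyMeasurable[ℱ k] fun ω => tikhonovBias f (lam (k + 1) ω) := fun k =>
    ((monotone_tikhonovBias hf_convex hf_diff.continuous hf_argmin).measurable.comp
      (hlam_pred k).measurable).stronglyMeasurable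
  have hVi : ∀ k, Integrable (fun ω => ‖X k ω - z‖ ^ 2) P := fun k =>
    ((hX.memLp_two hf_convex hf_diff hf_smooth hf_argmin hA hC hABC hα_pred hlam_pred hα hlam
      k).sub (memLp_const z)).integrable_norm_pow two_ne_zero
  -- Index `k` uses `α (k + 1)` and `lam (k + 1)`, which are `ℱ k`-measurable by predictability.
  have hRS := robbins_siegmund (P := P) (ℱ := ℱ) (V := fun k ω => ‖X k ω - z‖ ^ 2)
    (β := fun k ω => (2 * (L + c) ^ 2 + A * L) * α (k + 1) ω ^ 2)
    (γ := fun k ω => |α (k + 1) ω * lam (k + 1) ω| * ‖X k ω - z‖ ^ 2)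
    (η := fun k ω => |α (k + 1) ω * lam (k + 1) ω| * tikhonovBias f (lam (k + 1) ω)
          + (2 * c ^ 2 * ‖z‖ ^ 2 + C) * α (k + 1) ω ^ 2)
    hXm (fun k => ((hα_pred k).pow 2).const_mul _) (fun k => (hαlam k).mul (hXm k))
    (fun k => ((hαlam k).mul (hbm k)).add (((hα_pred k).pow 2).const_mul _))
    (fun k ω => by positivity) (fun k ω => by positivity) (fun k ω => by positivity)
    (fun k ω => add_nonneg (mul_nonneg (abs_nonneg _) (hb0 _)) (by positivity))
    hVi
    (fun k => (hVi k).bdd_mul (c := a * c) ((hαlam k).mono (ℱ.le k)).aestronglyMeasurable <| by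
      filter_upwards [hα k, hlam k] with ω h1 h2
      rw [Real.norm_eq_abs, abs_abs, abs_mul]
      exact mul_le_mul h1 h2 (abs_nonneg _) ((norm_nonneg _).trans h1))
    (hX.condExp_le hf_convex hf_diff hf_smooth hf_argmin hA hC hABC hα_pred hlam_pred hα hlam)
    (by filter_upwards [h_sum_sq] with ω hω using hω.mul_left _)
    (by
      filter_upwards [h_sum_sq, h_sum_bias, hX.step_nonneg, hX.reg_nonneg] with ω h1 h2 h3 h4
      refine (h2.congr fun k => ?_).add (h1.mul_left _)
      rw [abs_of_nonneg (mul_nonneg (h3 k) (h4 k)), mul_assoc, mul_assoc, mul_tikhonovBias (h4 k)])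
  filter_upwards [hRS, h_sum_div] with ω hω hdiv
  obtain ⟨⟨v, hv⟩, hs⟩ := hω
  have h0 := tendsto_zero_of_summable_mul (fun k => sq_nonneg ‖X k ω - z‖) hv hdiv hs
  rw [tendsto_iff_norm_sub_tendsto_zero]
  simpa using h0.sqrt
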